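/- Let $\Lambda$ be a linear order, not necessarily well-founded. The language $\mathcal L_\Lambda$ is built from countably many propositional variables, the constant $\top$, the connectives $\neg,\wedge$, and a unary modality $[\alpha]$ for each $\alpha\in\Lambda$; $\chi\to\psi$ and $\langle\alpha\rangle\chi:=\neg[\alpha]\neg\chi$ are the usual abbreviations. The logic $\mathsf{GLP}_\Lambda$ over $\mathcal L_\Lambda$ has as axioms all substitution instances of propositional tautologies and, for all $\alpha,\beta\in\Lambda$ and $\chi,\psi\in\mathcal L_\Lambda$, (i) $[\alpha](\chi\to\psi)\to([\alpha]\chi\to[\alpha]\psi)$; (ii) $[\alpha]([\alpha]\chi\to\chi)\to[\alpha]\chi$; (iii) $[\alpha]\chi\to[\beta][\alpha]\chi$ for $\alpha\le\beta$; (iv) $\langle\alpha\rangle\chi\to[\beta]\langle\alpha\rangle\chi$ for $\alpha<\beta$; (v) $[\alpha]\chi\to[\beta]\chi$ for $\alpha\le\beta$; its rules are modus ponens and necessitation $\chi/[\alpha]\chi$ for each $\alpha\in\Lambda$. For $S\subseteq\Lambda$, $\mathsf{GLP}_S$ is the same logic for $S$ with the induced order, so that all formulas in its derivations belong to $\mathcal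 L_S\subseteq\mathcal L_\Lambda$; $\mathsf{GLP}_n$ and $\mathsf{GLP}_\omega$ are the logics for $\{0<\dots<n-1\}$ and for the natural numbers. 1. For every $S\subseteq\Lambda$ and every formula $\varphi\in\mathcal L_S$: $\mathsf{GLP}_\Lambda\vdash\varphi$ if and only if $\mathsf{GLP}_S\vdash\varphi$. 2. For every $\varphi\in\mathcal L_\Lambda$, let $\alpha_0<\dots<\alpha_{n-1}$ be the modals that occur in $\varphi$, in increasing order, and let $\hat\varphi$ be the result of replacing each modality $[\alpha_i]$ in $\varphi$ by $[i]$. Then $$\mathsf{GLP}_\Lambda\vdash\varphi\iff\mathsf{GLP}_n\vdash\hat\varphi\iff\mathsf{GLP}_\omega\vdash\hat\varphi.$$ -/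

import Mathlib

universe u v

/-- Formulas of classical propositional logic over a countably infinite set of variables. -/
inductive PropFormula : Type
  | var (p : ℕ) : PropFormula
  | top : PropFormula
  | neg (τ : PropFormula) : PropFormula
  | and (τ₁ τ₂ : PropFormula) : PropFormula

namespace PropFormula

/-- The truth of a propositional formula under a truth assignment. -/
def Eval (v : ℕ → Prop) : PropFormula → Prop
  | var p => v p
  | top => True
  | neg τ => ¬ Eval v τ
  | and τ₁ τ₂ => Eval v τ₁ ∧ Eval v τ₂

/-- A propositional tautology is true under every truth assignment. -/
def IsTautology (τ : PropFormula) : Prop := ∀ v : ℕ → Prop, τ.Eval v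

end PropFormula

/-- The modal language `𝓛_Λ`: propositional variables from a countably infinite set, the constant
`⊤`, the connectives `¬`, `∧`, and a unary modality `[α]` for each `α : Λ`. -/
inductive ModalFormula (Λ : Type u) : Type u
  | var (p : ℕ) : ModalFormula Λ
  | top : ModalFormula Λ
  | neg (φ : ModalFormula Λ) : ModalFormula Λ
  | and (φ ψ : ModalFormula Λ) : ModalFormula Λ
  | box (α : Λ) (φ : ModalFormula Λ) : ModalFormula Λ

namespace ModalFormula

/-- Implication, `φ → ψ := ¬ (φ ∧ ¬ ψ)`. -/
def imp {Λ : Type u} (φ ψ : ModalFormula Λ) : ModalFormula Λ := neg (and φ (neg ψ))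

/-- The dual modality, `⟨α⟩ φ := ¬ [α] ¬ φ`. -/
def dia {Λ : Type u} (α : Λ) (φ : ModalFormula Λ) : ModalFormula Λ := neg (box α (neg φ))

/-- Replace each modality `[α]` in a formula by `[f α]`. -/
def rename {Λ : Type u} {Λ' : Type v} (f : Λ → Λ') : ModalFormula Λ → ModalFormula Λ'
  | var p => var p
  | top => top
  | neg φ => neg (rename f φ)
  | and φ ψ => and (rename f φ) (rename f ψ)
  | box α φ => box (f α) (rename f φ)

/-- The inclusion of the language `𝓛_S` in the language `𝓛_Λ`, for `S ⊆ Λ`. -/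
def incl {Λ : Type u} {S : Set Λ} (φ : ModalFormula S) : ModalFormula Λ :=
  φ.rename Subtype.val

/-- The finite set of the modals that occur in a formula. -/
def mods {Λ : Type u} [DecidableEq Λ] : ModalFormula Λ → Finset Λ
  | var _ => ∅
  | top => ∅
  | neg φ => mods φ
  | and φ ψ => mods φ ∪ mods ψ
  | box α φ => insert α (mods φ)

/-- A formula all of whose modals lie in the finite set `F`, read as a formula of `𝓛_F`. -/
def restrict {Λ : Type u} [DecidableEq Λ] (F : Finset Λ) :
    (φ : ModalFormula Λ) → φ.mods ⊆ F → ModalFormula F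
  | var p, _ => var p
  | top, _ => top
  | neg φ, h => neg (restrict F φ h)
  | and φ ψ, h =>
      and (restrict F φ (Finset.subset_union_left.trans h))
        (restrict F ψ (Finset.subset_union_right.trans h))
  | box α φ, h =>
      box ⟨α, h (Finset.mem_insert_self α _)⟩
        (restrict F φ ((Finset.subset_insert α _).trans h))

/-- Restricting a formula to the language `𝓛_F` does not change it. -/
theorem rename_restrict {Λ : Type u} [DecidableEq Λ] (F : Finset Λ) (φ : ModalFormula Λ)
    (h : φ.mods ⊆ F) : (restrict F φ h).rename Subtype.val = φ := by
  induction φ with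
  | var p => rfl
  | top => rfl
  | neg φ ih => exact congrArg neg (ih h)
  | and φ ψ ih₁ ih₂ => simp only [restrict, rename, ih₁, ih₂]
  | box α φ ih => simp only [restrict, rename, ih]

/-- The formula `φ̂`: with `α₀ < ⋯ < αₙ₋₁` the modals that occur in `φ`, in increasing order,
each modality `[αᵢ]` of `φ` is replaced by `[i]`. -/
def hat {Λ : Type u} [LinearOrder Λ] (φ : ModalFormula Λ) : ModalFormula (Fin φ.mods.card) :=
  (φ.restrict φ.mods (Finset.Subset.refl _)).rename (φ.mods.orderIsoOfFin rfl).symm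

end ModalFormula

/-- The result of substituting modal formulas for the variables of a propositional formula. -/
def PropFormula.subst {Λ : Type u} (σ : ℕ → ModalFormula Λ) : PropFormula → ModalFormula Λ
  | .var p => σ p
  | .top => .top
  | .neg τ => .neg (subst σ τ)
  | .and τ₁ τ₂ => .and (subst σ τ₁) (subst σ τ₂)

open ModalFormula in
/-- Provability in the logic `GLP_Λ`, for a linear order `Λ`: `GLP Λ φ` means `GLP_Λ ⊢ φ`. -/
inductive GLP (Λ : Type u) [LinearOrder Λ] : ModalFormula Λ → Prop
  | taut (τ : PropFormula) (hτ : τ.IsTautology) (σ : ℕ → ModalFormula Λ) : GLP Λ (τ.subst σ)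
  | distr (α : Λ) (χ ψ : ModalFormula Λ) :
      GLP Λ (imp (box α (imp χ ψ)) (imp (box α χ) (box α ψ)))
  | loeb (α : Λ) (χ : ModalFormula Λ) :
      GLP Λ (imp (box α (imp (box α χ) χ)) (box α χ))
  | box_box (α β : Λ) (h : α ≤ β) (χ : ModalFormula Λ) :
      GLP Λ (imp (box α χ) (box β (box α χ)))
  | dia_box_dia (α β : Λ) (h : α < β) (χ : ModalFormula Λ) :
      GLP Λ (imp (dia α χ) (box β (dia α χ)))
  | mono (α β : Λ) (h : α ≤ β) (χ : ModalFormula Λ) :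
      GLP Λ (imp (box α χ) (box β χ))
  | mp (χ ψ : ModalFormula Λ) (h₁ : GLP Λ (imp χ ψ)) (h₂ : GLP Λ χ) : GLP Λ ψ
  | nec (α : Λ) (χ : ModalFormula Λ) (h : GLP Λ χ) : GLP Λ (box α χ)

/-! Condensation is undone by the increasing enumeration of the modals, so everything reduces to
`GLP.rename_iff`. A derivation displays finitely many modals; erasing boxes at the others
(`GLP.exists_finset_proj`) and numbering the rest moves it into `GLP ℕ`. It remains to show that
natural-number levels outside a finite fragment prove nothing new about it (`GLP.of_rename_nat`).

That step is semantic. If `φ` is not provable in the fragment, it lies outside some maximal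
consistent set `t`. One needs a model of all of `GLP ℕ` whose root satisfies, among the subformulas
of `φ`, exactly the members of `t`. Since GLP is Kripke incomplete, monotonicity is demanded only of
an algebra of admissible sets.

The model is built downwards from a level above all modals (`exists_hasRoot`). To add level `i`,
copies of parts of the level `i + 1` model are strung along the ordinals up to `ω ^ r`, with `r` the
rank of its root, above models of successors of `t`; a point `w` occurs at the nonzero multiples of
`ω ^ rank w`. A successor of `w` at level `i + 1` in copy `x` then recurs in copies cofinal below
`x`, which level `i` sees. Admissible sets are eventually constant below limits, so they cannot
separate these occurrences: this is monotonicity from `i` to `i + 1`. Levels that code no modal are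
treated alike. -/

namespace ModalFormula

/-! ### Renaming and erasing modalities -/

theorem rename_rename {Λ : Type u} {Λ' : Type v} {Λ'' : Type*} (f : Λ → Λ') (g : Λ' → Λ'')
    (φ : ModalFormula Λ) : (φ.rename f).rename g = φ.rename (g ∘ f) := by
  induction φ <;> simp_all [rename]

theorem rename_subst {Λ : Type u} {Λ' : Type v} (f : Λ → Λ') (σ : ℕ → ModalFormula Λ)
    (τ : PropFormula) : (τ.subst σ).rename f = τ.subst fun p => (σ p).rename f := by
  induction τ <;> simp_all [rename, PropFormula.subst]

/-- Replace each subformula `[α] χ` with `α ∉ F` by `⊤`. -/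
def proj {Λ : Type u} [DecidableEq Λ] (F : Finset Λ) : ModalFormula Λ → ModalFormula F
  | var p => var p
  | top => top
  | neg φ => neg (proj F φ)
  | and φ ψ => and (proj F φ) (proj F ψ)
  | box α φ => if h : α ∈ F then box ⟨α, h⟩ (proj F φ) else top

theorem proj_subst {Λ : Type u} [DecidableEq Λ] (F : Finset Λ) (σ : ℕ → ModalFormula Λ)
    (τ : PropFormula) : (τ.subst σ).proj F = τ.subst fun p => (σ p).proj F := by
  induction τ <;> simp_all [proj, PropFormula.subst]

theorem proj_rename {Λ : Type u} {Λ' : Type v} [DecidableEq Λ'] (F : Finset Λ') (f : Λ → Λ')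
    (hf : ∀ α, f α ∈ F) (φ : ModalFormula Λ) :
    (φ.rename f).proj F = φ.rename fun α => ⟨f α, hf α⟩ := by
  induction φ <;> simp_all [rename, proj]

/-- A formula lies in a finite set of formulas that is closed under subformulas. -/
theorem exists_finite_subformula_closed {Λ : Type u} (φ : ModalFormula Λ) :
    ∃ D : Set (ModalFormula Λ), D.Finite ∧ φ ∈ D ∧ (∀ ψ, neg ψ ∈ D → ψ ∈ D) ∧
      (∀ ψ χ, and ψ χ ∈ D → ψ ∈ D ∧ χ ∈ D) ∧ (∀ α ψ, box α ψ ∈ D → ψ ∈ D) := by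
  induction φ with
  | var p => exact ⟨{var p}, by simp⟩
  | top => exact ⟨{top}, by simp⟩
  | neg φ ih =>
    obtain ⟨D, hD, h, h1, h2, h3⟩ := ih
    refine ⟨insert (neg φ) D, hD.insert _, by simp, ?_, ?_, ?_⟩ <;> grind
  | and φ ψ ih₁ ih₂ =>
    obtain ⟨D, hD, h, h1, h2, h3⟩ := ih₁
    obtain ⟨E, hE, k, k1, k2, k3⟩ := ih₂
    refine ⟨insert (and φ ψ) (D ∪ E), (hD.union hE).insert _, by simp, ?_, ?_, ?_⟩ <;> grind
  | box α φ ih =>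
    obtain ⟨D, hD, h, h1, h2, h3⟩ := ih
    refine ⟨insert (box α φ) D, hD.insert _, by simp, ?_, ?_, ?_⟩ <;> grind

end ModalFormula

open ModalFormula

/-- Provability is preserved by strictly monotone renamings of the modalities. -/
theorem GLP.rename {Λ : Type u} {Λ' : Type v} [LinearOrder Λ] [LinearOrder Λ'] {f : Λ → Λ'}
    (hf : StrictMono f) {φ : ModalFormula Λ} (h : GLP Λ φ) : GLP Λ' (φ.rename f) := by
  induction h with
  | taut τ hτ σ => rw [rename_subst]; exact .taut τ hτ _
  | distr α χ ψ => exact .distr _ _ _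
  | loeb α χ => exact .loeb _ _
  | box_box α β h χ => exact .box_box _ _ (hf.monotone h) _
  | dia_box_dia α β h χ => exact .dia_box_dia _ _ (hf h) _
  | mono α β h χ => exact .mono _ _ (hf.monotone h) _
  | mp χ ψ _ _ ih₁ ih₂ => exact .mp _ _ ih₁ ih₂
  | nec α χ _ ih => exact .nec _ _ ih

/-- A derivation uses only finitely many modalities. -/
theorem GLP.exists_finset_proj {Λ : Type u} [LinearOrder Λ] {φ : ModalFormula Λ} (h : GLP Λ φ) :
    ∃ F : Finset Λ, ∀ G : Finset Λ, F ⊆ G → GLP G (φ.proj G) := by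
  induction h with
  | taut τ hτ σ => exact ⟨∅, fun G _ => by rw [proj_subst]; exact .taut τ hτ _⟩
  | distr α χ ψ =>
    -- Only the displayed modal must survive; boxes inside `χ` and `ψ` may be erased.
    refine ⟨{α}, fun G hG => ?_⟩
    have h₁ : α ∈ G := hG (by simp)
    simp only [imp, proj, h₁, dif_pos]
    exact .distr _ _ _
  | loeb α χ =>
    refine ⟨{α}, fun G hG => ?_⟩
    have h₁ : α ∈ G := hG (by simp)
    simp only [imp, proj, h₁, dif_pos]
    exact .loeb _ _
  | box_box α β h χ =>
    refine ⟨{α, β}, fun G hG => ?_⟩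
    have h₁ : α ∈ G := hG (by simp)
    have h₂ : β ∈ G := hG (by simp)
    simp only [imp, proj, h₁, h₂, dif_pos]
    exact GLP.box_box (Λ := G) ⟨α, h₁⟩ ⟨β, h₂⟩ h _
  | dia_box_dia α β h χ =>
    refine ⟨{α, β}, fun G hG => ?_⟩
    have h₁ : α ∈ G := hG (by simp)
    have h₂ : β ∈ G := hG (by simp)
    simp only [imp, dia, proj, h₁, h₂, dif_pos]
    exact GLP.dia_box_dia (Λ := G) ⟨α, h₁⟩ ⟨β, h₂⟩ h _
  | mono α β h χ =>
    refine ⟨{α, β}, fun G hG => ?_⟩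
    have h₁ : α ∈ G := hG (by simp)
    have h₂ : β ∈ G := hG (by simp)
    simp only [imp, proj, h₁, h₂, dif_pos]
    exact GLP.mono (Λ := G) ⟨α, h₁⟩ ⟨β, h₂⟩ h _
  | mp χ ψ _ _ ih₁ ih₂ =>
    obtain ⟨F₁, h₁⟩ := ih₁
    obtain ⟨F₂, h₂⟩ := ih₂
    -- Stability under enlarging the set lets both premises be erased with the same `G`.
    exact ⟨F₁ ∪ F₂, fun G hG => .mp _ _ (h₁ G (Finset.union_subset_left hG))
      (h₂ G (Finset.union_subset_right hG))⟩
  | nec α χ _ ih =>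
    obtain ⟨F, hF⟩ := ih
    refine ⟨insert α F, fun G hG => ?_⟩
    have h₁ : α ∈ G := hG (by simp)
    simp only [proj, h₁, dif_pos]
    exact .nec _ _ (hF G ((Finset.subset_insert _ _).trans hG))

/-! ### Maximal consistent sets and canonical successors -/

section Deriv

variable {S : Type u} [LinearOrder S]

/-- Derivability from a set of assumptions, without necessitation of the assumptions. -/
inductive Deriv (Γ : Set (ModalFormula S)) : ModalFormula S → Prop
  | thm {φ} (h : GLP S φ) : Deriv Γ φ
  | hyp {φ} (h : φ ∈ Γ) : Deriv Γ φ
  | mp {φ ψ} (h₁ : Deriv Γ (imp φ ψ)) (h₂ : Deriv Γ φ) : Deriv Γ ψ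

namespace GLP

theorem imp_intro (χ ψ : ModalFormula S) : GLP S (imp χ (imp ψ χ)) :=
  taut (.neg (.and (.var 0) (.neg (.neg (.and (.var 1) (.neg (.var 0)))))))
    (fun v => by simp only [PropFormula.Eval]; tauto) fun n => if n = 0 then χ else ψ

theorem imp_distr (χ ψ θ : ModalFormula S) :
    GLP S (imp (imp χ (imp ψ θ)) (imp (imp χ ψ) (imp χ θ))) :=
  let i : PropFormula → PropFormula → PropFormula := fun a b => .neg (.and a (.neg b))
  taut (i (i (.var 0) (i (.var 1) (.var 2))) (i (i (.var 0) (.var 1)) (i (.var 0) (.var 2))))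
    (fun v => by simp only [PropFormula.Eval, i]; tauto)
    fun n => if n = 0 then χ else if n = 1 then ψ else θ

theorem imp_self (χ : ModalFormula S) : GLP S (imp χ χ) :=
  taut (.neg (.and (.var 0) (.neg (.var 0)))) (fun v => by simp only [PropFormula.Eval]; tauto)
    fun _ => χ

theorem by_cases (χ ψ : ModalFormula S) :
    GLP S (imp (imp χ ψ) (imp (imp (neg χ) ψ) ψ)) :=
  let i : PropFormula → PropFormula → PropFormula := fun a b => .neg (.and a (.neg b))
  taut (i (i (.var 0) (.var 1)) (i (i (.neg (.var 0)) (.var 1)) (.var 1)))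
    (fun v => by simp only [PropFormula.Eval, i]; tauto) fun n => if n = 0 then χ else ψ

theorem absurd (χ ψ : ModalFormula S) : GLP S (imp (neg χ) (imp χ ψ)) :=
  let i : PropFormula → PropFormula → PropFormula := fun a b => .neg (.and a (.neg b))
  taut (i (.neg (.var 0)) (i (.var 0) (.var 1)))
    (fun v => by simp only [PropFormula.Eval, i]; tauto) fun n => if n = 0 then χ else ψ

theorem and_intro (χ ψ : ModalFormula S) : GLP S (imp χ (imp ψ (and χ ψ))) :=
  let i : PropFormula → PropFormula → PropFormula := fun a b => .neg (.and a (.neg b))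
  taut (i (.var 0) (i (.var 1) (.and (.var 0) (.var 1))))
    (fun v => by simp only [PropFormula.Eval, i]; tauto) fun n => if n = 0 then χ else ψ

theorem and_left (χ ψ : ModalFormula S) : GLP S (imp (and χ ψ) χ) :=
  taut (.neg (.and (.and (.var 0) (.var 1)) (.neg (.var 0))))
    (fun v => by simp only [PropFormula.Eval]; tauto) fun n => if n = 0 then χ else ψ

theorem and_right (χ ψ : ModalFormula S) : GLP S (imp (and χ ψ) ψ) :=
  taut (.neg (.and (.and (.var 0) (.var 1)) (.neg (.var 1))))
    (fun v => by simp only [PropFormula.Eval]; tauto) fun n => if n = 0 then χ else ψ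

theorem neg_neg_elim (χ : ModalFormula S) : GLP S (imp (neg (neg χ)) χ) :=
  taut (.neg (.and (.neg (.neg (.var 0))) (.neg (.var 0))))
    (fun v => by simp only [PropFormula.Eval]; tauto) fun _ => χ

theorem neg_neg_intro (χ : ModalFormula S) : GLP S (imp χ (neg (neg χ))) :=
  taut (.neg (.and (.var 0) (.neg (.neg (.neg (.var 0))))))
    (fun v => by simp only [PropFormula.Eval]; tauto) fun _ => χ

theorem contrapose (χ ψ : ModalFormula S) :
    GLP S (imp (imp χ ψ) (imp (neg ψ) (neg χ))) :=
  let i : PropFormula → PropFormula → PropFormula := fun a b => .neg (.and a (.neg b))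
  taut (i (i (.var 0) (.var 1)) (i (.neg (.var 1)) (.neg (.var 0))))
    (fun v => by simp only [PropFormula.Eval, i]; tauto) fun n => if n = 0 then χ else ψ

theorem top_intro : GLP S (top : ModalFormula S) :=
  taut .top (fun _ => trivial) fun _ => top

end GLP

namespace Deriv

theorem weaken {Γ Γ' : Set (ModalFormula S)} (h : Γ ⊆ Γ') {φ : ModalFormula S}
    (d : Deriv Γ φ) : Deriv Γ' φ := by
  induction d with
  | thm h => exact .thm h
  | hyp h' => exact .hyp (h h')
  | mp _ _ ih₁ ih₂ => exact .mp ih₁ ih₂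

theorem deduction {Γ : Set (ModalFormula S)} {χ φ : ModalFormula S}
    (d : Deriv (insert χ Γ) φ) : Deriv Γ (imp χ φ) := by
  induction d with
  | thm h => exact .mp (.thm (GLP.imp_intro _ _)) (.thm h)
  | hyp h =>
    rcases h with rfl | h
    · exact .thm (GLP.imp_self _)
    · exact .mp (.thm (GLP.imp_intro _ _)) (.hyp h)
  | mp _ _ ih₁ ih₂ => exact .mp (.mp (.thm (GLP.imp_distr _ _ _)) ih₁) ih₂

theorem of_sUnion {c : Set (Set (ModalFormula S))} (hc : IsChain (· ⊆ ·) c) (hne : c.Nonempty)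
    {φ : ModalFormula S} (d : Deriv (⋃₀ c) φ) : ∃ Γ ∈ c, Deriv Γ φ := by
  induction d with
  | thm h => exact ⟨_, hne.some_mem, .thm h⟩
  | hyp h => exact ⟨_, h.choose_spec.1, .hyp h.choose_spec.2⟩
  | mp _ _ ih₁ ih₂ =>
    obtain ⟨Γ, hΓ, h₁⟩ := ih₁
    obtain ⟨Γ', hΓ', h₂⟩ := ih₂
    rcases hc.total hΓ hΓ' with h | h
    · exact ⟨Γ', hΓ', .mp (h₁.weaken h) h₂⟩
    · exact ⟨Γ, hΓ, .mp h₁ (h₂.weaken h)⟩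

end Deriv

/-- Maximal consistent sets of formulas. -/
structure IsMCS (t : Set (ModalFormula S)) : Prop where
  thm_mem : ∀ {φ}, GLP S φ → φ ∈ t
  mp_mem : ∀ {φ ψ}, imp φ ψ ∈ t → φ ∈ t → ψ ∈ t
  neg_mem : ∀ {φ}, neg φ ∈ t ↔ φ ∉ t

theorem IsMCS.and_mem {t : Set (ModalFormula S)} (ht : IsMCS t) {φ ψ : ModalFormula S} :
    and φ ψ ∈ t ↔ φ ∈ t ∧ ψ ∈ t :=
  ⟨fun h => ⟨ht.mp_mem (ht.thm_mem (GLP.and_left _ _)) h,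
    ht.mp_mem (ht.thm_mem (GLP.and_right _ _)) h⟩,
   fun h => ht.mp_mem (ht.mp_mem (ht.thm_mem (GLP.and_intro _ _)) h.1) h.2⟩

/-- Take `t` maximal among the sets not deriving `χ`. Every formula outside `t` implies `χ` over
`t`, so `φ` and `neg φ` cannot both be missing. -/
theorem exists_isMCS {Γ : Set (ModalFormula S)} {χ : ModalFormula S} (h : ¬ Deriv Γ χ) :
    ∃ t, IsMCS t ∧ Γ ⊆ t ∧ χ ∉ t := by
  obtain ⟨t, hΓt, ht⟩ := zorn_subset_nonempty {T : Set (ModalFormula S) | ¬ Deriv T χ}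
    (fun c hc hchain hne => ⟨⋃₀ c, fun d => by
      obtain ⟨T, hT, d⟩ := d.of_sUnion hchain hne
      exact hc hT d, fun T hT => Set.subset_sUnion_of_mem hT⟩) Γ h
  have hcon : ¬ Deriv t χ := ht.prop
  have hins : ∀ φ, φ ∉ t → Deriv t (imp φ χ) := fun φ hφ => by
    by_contra hd
    exact hφ (ht.le_of_ge (y := insert φ t) (fun d => hd d.deduction)
      (Set.subset_insert _ _) (Set.mem_insert _ _))
  have hcl : ∀ φ, Deriv t φ → φ ∈ t := fun φ d => by
    by_contra hφ
    exact hcon (.mp (hins φ hφ) d)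
  refine ⟨t, ⟨fun h => hcl _ (.thm h), fun h₁ h₂ => hcl _ (.mp (.hyp h₁) (.hyp h₂)), ?_⟩, hΓt,
    fun h => hcon (.hyp h)⟩
  intro φ
  refine ⟨fun h₁ h₂ => hcon (.mp (.mp (.thm (GLP.absurd φ χ)) (.hyp h₁)) (.hyp h₂)), fun h₁ => ?_⟩
  by_contra h₂
  exact hcon (.mp (.mp (.thm (GLP.by_cases φ χ)) (hins _ h₁)) (hins _ h₂))

/-- The formulas boxed in a maximal consistent set are closed under derivability. -/
theorem IsMCS.box_mem_of_deriv {t : Set (ModalFormula S)} (ht : IsMCS t) {α : S}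
    {Γ : Set (ModalFormula S)} (hΓ : ∀ γ ∈ Γ, box α γ ∈ t) {φ : ModalFormula S}
    (d : Deriv Γ φ) : box α φ ∈ t := by
  induction d with
  | thm h => exact ht.thm_mem (.nec _ _ h)
  | hyp h => exact hΓ _ h
  | mp _ _ ih₁ ih₂ => exact ht.mp_mem (ht.mp_mem (ht.thm_mem (.distr _ _ _)) ih₁) ih₂

/-- Negative introspection from `dia_box_dia`, up to double negations. It forces an `α`-successor to
have no new boxes below `α`. -/
theorem IsMCS.box_neg_box_mem {t : Set (ModalFormula S)} (ht : IsMCS t) {α β : S} (hβ : β < α)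
    {ψ : ModalFormula S} (h : box β ψ ∉ t) : box α (neg (box β ψ)) ∈ t := by
  have hd : ∀ γ : S, ∀ χ θ : ModalFormula S, GLP S (imp χ θ) → box γ χ ∈ t → box γ θ ∈ t :=
    fun γ χ θ hi hb => ht.mp_mem (ht.mp_mem (ht.thm_mem (.distr _ _ _)) (ht.thm_mem (.nec _ _ hi))) hb
  have h₁ : dia β (neg ψ) ∈ t :=
    ht.neg_mem.2 fun hb => h (hd _ _ _ (GLP.neg_neg_elim ψ) hb)
  have h₂ : box α (dia β (neg ψ)) ∈ t := ht.mp_mem (ht.thm_mem (.dia_box_dia _ _ hβ _)) h₁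
  refine hd _ _ _ (.mp _ _ (GLP.contrapose _ _) ?_) h₂
  exact .mp _ _ (.distr _ _ _) (.nec _ _ (GLP.neg_neg_intro ψ))

/-- The existence lemma for the canonical model, in the form that Löb's axiom provides. -/
theorem IsMCS.exists_succ {t : Set (ModalFormula S)} (ht : IsMCS t) {α : S} {χ : ModalFormula S}
    (h : box α χ ∉ t) : ∃ t', IsMCS t' ∧ χ ∉ t' ∧ box α χ ∈ t' ∧
      (∀ β ≤ α, ∀ ψ, box β ψ ∈ t → box β ψ ∈ t' ∧ ψ ∈ t') ∧
      (∀ β < α, ∀ ψ, box β ψ ∈ t' ↔ box β ψ ∈ t) := by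
  let Γ : Set (ModalFormula S) := {γ | box α γ ∈ t}
  -- Otherwise `[α]([α]χ → χ)` would lie in `t`, and Löb's axiom would put `[α]χ` there.
  have hcon : ¬ Deriv (insert (box α χ) Γ) χ := fun d =>
    h (ht.mp_mem (ht.thm_mem (.loeb _ _))
      (ht.box_mem_of_deriv (Γ := Γ) (fun _ hγ => hγ) d.deduction))
  obtain ⟨t', ht', hΓ, hχ⟩ := exists_isMCS hcon
  have hsub : ∀ γ, box α γ ∈ t → γ ∈ t' := fun γ hγ => hΓ (Set.mem_insert_of_mem _ hγ)
  have hpos : ∀ β ≤ α, ∀ ψ, box β ψ ∈ t → box β ψ ∈ t' ∧ ψ ∈ t' := fun β hβ ψ hψ =>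
    ⟨hsub _ (ht.mp_mem (ht.thm_mem (.box_box _ _ hβ _)) hψ),
      hsub _ (ht.mp_mem (ht.thm_mem (.mono _ _ hβ _)) hψ)⟩
  refine ⟨t', ht', hχ, hΓ (Set.mem_insert _ _), hpos, fun β hβ ψ => ⟨fun hψ => ?_,
    fun hψ => (hpos β hβ.le ψ hψ).1⟩⟩
  by_contra hn
  exact ht'.neg_mem.1 (hsub _ (ht.box_neg_box_mem hβ hn)) hψ

end Deriv

/-! ### Multiples of powers of ω -/

section Ordinal

open Ordinal Order

/-- With `x = ω ^ s * (ω * k)` and `ω * k` a limit, the multiples of `ω ^ s` are cofinal in `x`. -/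
theorem Ordinal.exists_omega0_opow_dvd_between {r s x y : Ordinal.{u}} (hs : s < r)
    (hx : x ≠ 0) (hr : ω ^ r ∣ x) (hy : y < x) : ∃ z, y < z ∧ z < x ∧ z ≠ 0 ∧ ω ^ s ∣ z := by
  obtain ⟨k, rfl⟩ := (opow_dvd_opow ω (Order.succ_le_of_lt hs)).trans hr
  rw [opow_succ, mul_assoc] at hy hx ⊢
  have hlim : IsSuccLimit (ω * k) := by
    rw [isSuccLimit_iff, isSuccPrelimit_iff_omega0_dvd]
    exact ⟨right_ne_zero_of_mul hx, dvd_mul_right _ _⟩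
  obtain ⟨c, hc, hyc⟩ := (lt_mul_iff_of_isSuccLimit hlim).1 hy
  exact ⟨ω ^ s * c, hyc, mul_lt_mul_of_pos_left hc (opow_pos _ omega0_pos),
    (bot_le.trans_lt hyc).ne', dvd_mul_right _ _⟩

theorem Ordinal.isSuccLimit_of_omega0_opow_dvd {r s x : Ordinal.{u}} (hs : s < r) (hx : x ≠ 0)
    (hr : ω ^ r ∣ x) : IsSuccLimit x := by
  rw [isSuccLimit_iff, isSuccPrelimit_iff_omega0_dvd]
  refine ⟨hx, dvd_trans ?_ hr⟩
  have h := opow_dvd_opow ω (Order.one_le_iff_pos.2 (bot_le.trans_lt hs))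
  rwa [opow_one] at h

end Ordinal

/-! ### Labelled models and disjoint unions -/

/-- Kripke models for the modalities `[j]` with `j ≥ i`, labelled by maximal consistent sets. The
monotonicity axioms are only required of the admissible sets. -/
structure LabelledModel {S : Type} [LinearOrder S] (e : S → ℕ) (D : Set (ModalFormula S))
    (i : ℕ) where
  /-- The points. -/
  W : Type 1
  /-- The accessibility relations. -/
  R : ℕ → W → W → Prop
  /-- The ranks witnessing converse well-foundedness. -/
  rank : ℕ → W → Ordinal.{0}
  /-- The admissible sets. -/
  adm : Set (Set W)
  /-- The labels. -/
  typ : W → Set (ModalFormula S)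
  typ_isMCS : ∀ w, IsMCS (typ w)
  le_of_rel : ∀ {j x y}, R j x y → i ≤ j
  trans : ∀ {j k x y z}, j ≤ k → R k x y → R j y z → R j x z
  eucl : ∀ {j k x y z}, j < k → R k x y → R j x z → R j y z
  rank_lt : ∀ {j x y}, R j x y → rank j y < rank j x
  -- This keeps successors of a point in every copy that contains the point.
  rank_le : ∀ {j x y}, R j x y → rank i y ≤ rank i x
  exists_bound : ∃ b, ∀ x, rank i x < b
  adm_univ : Set.univ ∈ adm
  adm_compl : ∀ {b}, b ∈ adm → bᶜ ∈ adm
  adm_inter : ∀ {b c}, b ∈ adm → c ∈ adm → b ∩ c ∈ adm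
  adm_box : ∀ {b} j, b ∈ adm → {x | ∀ y, R j x y → y ∈ b} ∈ adm
  adm_var : ∀ p, {x | .var p ∈ typ x} ∈ adm
  mono : ∀ {b j k x}, b ∈ adm → i ≤ j → j ≤ k → (∀ y, R j x y → y ∈ b) → ∀ y, R k x y → y ∈ b
  box_mem_typ : ∀ {α ψ x}, i ≤ e α → box α ψ ∈ D →
    (box α ψ ∈ typ x ↔ ∀ y, R (e α) x y → ψ ∈ typ y)

namespace LabelledModel

variable {S : Type} [LinearOrder S] {e : S → ℕ} {D : Set (ModalFormula S)} {i : ℕ}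

theorem adm_empty (M : LabelledModel e D i) : ∅ ∈ M.adm := by
  simpa using M.adm_compl M.adm_univ

/-- The accessibility relations of a disjoint union. -/
inductive SigmaRel {ι : Type} (M : ι → LabelledModel e D i) (j : ℕ) :
    (Σ c, (M c).W) → (Σ c, (M c).W) → Prop
  | mk {c x y} (h : (M c).R j x y) : SigmaRel M j ⟨c, x⟩ ⟨c, y⟩

theorem sigmaRel_iff {ι : Type} {M : ι → LabelledModel e D i} {j : ℕ} {c : ι} {x : (M c).W}
    {q : Σ c, (M c).W} : SigmaRel M j ⟨c, x⟩ q ↔ ∃ y, (M c).R j x y ∧ q = ⟨c, y⟩ :=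
  ⟨fun h => by cases h with | mk h => exact ⟨_, h, rfl⟩, fun ⟨_, h, hq⟩ => hq ▸ ⟨h⟩⟩

/-- Disjoint unions. -/
def sigma {ι : Type} (M : ι → LabelledModel e D i) : LabelledModel e D i where
  W := Σ c, (M c).W
  R := SigmaRel M
  rank j p := (M p.1).rank j p.2
  adm := {b | ∀ c, {x | (⟨c, x⟩ : Σ c, (M c).W) ∈ b} ∈ (M c).adm}
  typ p := (M p.1).typ p.2
  typ_isMCS p := (M p.1).typ_isMCS p.2
  le_of_rel h := by cases h with | mk h => exact (M _).le_of_rel h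
  trans hjk h₁ h₂ := by
    cases h₁ with | mk h₁ => cases h₂ with | mk h₂ => exact ⟨(M _).trans hjk h₁ h₂⟩
  eucl hjk h₁ h₂ := by
    cases h₁ with | mk h₁ => cases h₂ with | mk h₂ => exact ⟨(M _).eucl hjk h₁ h₂⟩
  rank_lt h := by cases h with | mk h => exact (M _).rank_lt h
  rank_le h := by cases h with | mk h => exact (M _).rank_le h
  exists_bound := by
    choose b hb using fun c => (M c).exists_bound
    exact ⟨⨆ c, b c, fun p => (hb p.1 p.2).trans_le (le_ciSup Ordinal.bddAbove_of_small p.1)⟩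
  adm_univ c := (M c).adm_univ
  adm_compl h c := (M c).adm_compl (h c)
  adm_inter h h' c := (M c).adm_inter (h c) (h' c)
  adm_box j h c := by
    convert (M c).adm_box j (h c) using 1
    ext x
    simp only [Set.mem_ofPred_eq, sigmaRel_iff]
    exact ⟨fun H y hy => H _ ⟨y, hy, rfl⟩, by rintro H _ ⟨y, hy, rfl⟩; exact H y hy⟩
  adm_var p c := (M c).adm_var p
  mono {b j k x} hb hi hjk h y hy := by
    cases hy with
    | @mk c x y hy =>
      exact (M c).mono (hb c) hi hjk (fun z hz => h _ ⟨hz⟩) y hy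
  box_mem_typ {α ψ x} hi hD := by
    obtain ⟨c, x⟩ := x
    rw [(M c).box_mem_typ hi hD]
    simp only [sigmaRel_iff]
    exact ⟨by rintro H _ ⟨y, hy, rfl⟩; exact H y hy, fun H y hy => H _ ⟨y, hy, rfl⟩⟩

/-! ### Chains of copies: adding one level below -/

open Ordinal Order

/-- The points of the transfinite chain of copies of initial parts of `W`: a point `w` belongs to
the copies whose position is a nonzero multiple of `ω ^ rank w`. -/
def ChainPt (W : LabelledModel e D (i + 1)) (l : Ordinal.{0}) : Type 1 :=
  {p : Ordinal.{0} × W.W // p.1 ≠ 0 ∧ p.1 ≤ l ∧ ω ^ W.rank (i + 1) p.2 ∣ p.1}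

/-- The accessibility relations of a chain of copies of `W` above `B`. -/
def chainRel (B : LabelledModel e D i) (W : LabelledModel e D (i + 1)) (l : Ordinal.{0}) (j : ℕ) :
    B.W ⊕ ChainPt W l → B.W ⊕ ChainPt W l → Prop
  | .inl u, .inl v => B.R j u v
  | .inl _, .inr _ => False
  | .inr _, .inl _ => j = i
  | .inr p, .inr q => (j = i ∧ q.1.1 < p.1.1) ∨ (q.1.1 = p.1.1 ∧ W.R j p.1.2 q.1.2)

/-- The successor of a chain point for an upper modality, in the same copy. -/
def ChainPt.move {W : LabelledModel e D (i + 1)} {l : Ordinal.{0}} (p : ChainPt W l) {j : ℕ}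
    {w : W.W} (h : W.R j p.1.2 w) : ChainPt W l :=
  ⟨(p.1.1, w), p.2.1, p.2.2.1, (opow_dvd_opow ω (W.rank_le h)).trans p.2.2.2⟩

/-- The admissible sets of a chain: families of admissible sets of `W` that are eventually constant
below each limit. -/
def chainAdm (B : LabelledModel e D i) (W : LabelledModel e D (i + 1)) (l : Ordinal.{0}) :
    Set (Set (B.W ⊕ ChainPt W l)) :=
  {b | {u | .inl u ∈ b} ∈ B.adm ∧ ∃ a : Ordinal.{0} → Set W.W, (∀ x, a x ∈ W.adm) ∧
    (∀ x, IsSuccLimit x → ∃ y < x, ∀ z, y ≤ z → z < x → a z = a x) ∧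
    ∀ p : ChainPt W l, .inr p ∈ b ↔ p.1.2 ∈ a p.1.1}

/-- At chain points, membership in this box depends only on the position and is inherited by lower
positions, so it is eventually constant below each limit. -/
theorem chainAdm_box_self {B : LabelledModel e D i} {W : LabelledModel e D (i + 1)}
    {l : Ordinal.{0}} {b : Set (B.W ⊕ ChainPt W l)} (hb : b ∈ chainAdm B W l) :
    {x | ∀ y, chainRel B W l i x y → y ∈ b} ∈ chainAdm B W l := by
  obtain ⟨hB, -⟩ := hb
  let P : Ordinal.{0} → Prop := fun x =>
    (∀ u, .inl u ∈ b) ∧ ∀ q : ChainPt W l, q.1.1 < x → .inr q ∈ b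
  refine ⟨?_, fun x => {_w | P x}, fun x => ?_, fun x hx => ?_, fun p => ?_⟩
  · convert B.adm_box i hB using 1
    ext u
    exact ⟨fun h v hv => h (.inl v) hv, fun h y hy => by
      rcases y with v | q
      · exact h v hy
      · exact hy.elim⟩
  · by_cases h : P x
    · simpa [h] using W.adm_univ
    · simpa [h] using W.adm_empty
  · by_cases h : P x
    · refine ⟨0, hx.bot_lt, fun z _ hz => ?_⟩
      have hz' : P z := ⟨h.1, fun q hq => h.2 q (hq.trans hz)⟩
      simp [h, hz']
    · by_cases hu : ∀ u, .inl u ∈ b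
      · obtain ⟨q, hq, hqb⟩ : ∃ q : ChainPt W l, q.1.1 < x ∧ .inr q ∉ b := by
          by_contra! hc
          exact h ⟨hu, hc⟩
        refine ⟨succ q.1.1, hx.succ_lt hq, fun z hz _ => ?_⟩
        have hz' : ¬ P z := fun hP => hqb (hP.2 q (succ_le_iff.1 hz))
        simp [h, hz']
      · refine ⟨0, hx.bot_lt, fun z _ hz => ?_⟩
        have hz' : ¬ P z := fun hP => hu hP.1
        simp [h, hz']
  · refine ⟨fun h => ⟨fun u => h (.inl u) rfl, fun q hq => h (.inr q) (.inl ⟨rfl, hq⟩)⟩,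
      fun h y hy => ?_⟩
    rcases y with u | q
    · exact h.1 u
    · rcases hy with hy | hy
      · exact h.2 q hy.2
      · exact absurd (W.le_of_rel hy.2) (by omega)

theorem chainAdm_box {B : LabelledModel e D i} {W : LabelledModel e D (i + 1)}
    {l : Ordinal.{0}} {b : Set (B.W ⊕ ChainPt W l)} (j : ℕ) (hb : b ∈ chainAdm B W l) :
    {x | ∀ y, chainRel B W l j x y → y ∈ b} ∈ chainAdm B W l := by
  by_cases hj : j = i
  · subst hj
    exact chainAdm_box_self hb
  obtain ⟨hB, a, ha, hlim, hab⟩ := hb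
  refine ⟨?_, fun x => {w | ∀ w', W.R j w w' → w' ∈ a x}, fun x => W.adm_box j (ha x),
    fun x hx => ?_, fun p => ?_⟩
  · convert B.adm_box j hB using 1
    ext u
    exact ⟨fun h v hv => h (.inl v) hv, fun h y hy => by
      rcases y with v | q
      · exact h v hy
      · exact hy.elim⟩
  · obtain ⟨y, hy, h⟩ := hlim x hx
    exact ⟨y, hy, fun z hz hzx => by simp only [h z hz hzx]⟩
  · refine ⟨fun h w' hw' => ?_, fun h y hy => ?_⟩
    · exact (hab (p.move hw')).1 (h (.inr (p.move hw')) (.inr ⟨rfl, hw'⟩))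
    · rcases y with u | q
      · exact absurd hy hj
      · rcases hy with hy | hy
        · exact absurd hy.1 hj
        · rw [hab, hy.1]
          exact h _ hy.2

/-- Monotonicity between the new modality and the least old one. -/
theorem chainAdm_mono {B : LabelledModel e D i} {W : LabelledModel e D (i + 1)}
    {l : Ordinal.{0}} {b : Set (B.W ⊕ ChainPt W l)} (hb : b ∈ chainAdm B W l) {p : ChainPt W l}
    (h : ∀ y, chainRel B W l i (.inr p) y → y ∈ b) {k : ℕ} (hk : i < k) {q : ChainPt W l}
    (hq : q.1.1 = p.1.1) (hR : W.R k p.1.2 q.1.2) : .inr q ∈ b := by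
  obtain ⟨hB, a, ha, hlim, hab⟩ := hb
  rw [hab, hq]
  -- Monotonicity in `W` reduces level `k` to level `i + 1`, where ranks strictly drop.
  refine W.mono (ha p.1.1) le_rfl hk (fun w hw => ?_) _ hR
  have hlt := W.rank_lt hw
  obtain ⟨y, hy, hconst⟩ := hlim _ (isSuccLimit_of_omega0_opow_dvd hlt p.2.1 p.2.2.2)
  -- `w` recurs in a copy `z` so close below that the admissible set looks the same there.
  obtain ⟨z, hyz, hz, hz0, hdvd⟩ := exists_omega0_opow_dvd_between hlt p.2.1 p.2.2.2 hy
  rw [← hconst z hyz.le hz]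
  let r : ChainPt W l := ⟨(z, w), hz0, hz.le.trans p.2.2.1, hdvd⟩
  exact (hab r).1 (h (.inr r) (.inl ⟨rfl, hz⟩))

/-- The chain of copies of initial parts of `W` above `B`, ending with a full copy of the part of `W`
generated by `w₀`. -/
noncomputable def chain (B : LabelledModel e D i) (W : LabelledModel e D (i + 1)) (w₀ : W.W)
    (hW : ∀ w, w = w₀ ∨ ∀ α ψ, e α ≤ i + 1 → box α ψ ∈ W.typ w₀ → ψ ∈ W.typ w)
    (hW' : ∀ w α ψ, e α < i + 1 → (box α ψ ∈ W.typ w ↔ box α ψ ∈ W.typ w₀))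
    (hB : ∀ v α ψ, e α = i → box α ψ ∈ W.typ w₀ → ψ ∈ B.typ v)
    (hB' : ∀ α ψ, e α = i → box α ψ ∈ D → box α ψ ∉ W.typ w₀ → ∃ v, ψ ∉ B.typ v) :
    LabelledModel e D i where
  W := B.W ⊕ ChainPt W (ω ^ W.rank (i + 1) w₀)
  R := chainRel B W _
  rank j := Sum.elim (B.rank j)
    -- At level `i` every copy lies above all of `B`, so positions are counted from a bound on the
    -- ranks of `B`.
    fun p => if j = i then B.exists_bound.choose + p.1.1 else W.rank j p.1.2
  adm := chainAdm B W _
  typ := Sum.elim B.typ fun p => W.typ p.1.2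
  typ_isMCS := by
    rintro (u | p)
    · exact B.typ_isMCS u
    · exact W.typ_isMCS p.1.2
  le_of_rel {j x y} h := by
    rcases x with u | p <;> rcases y with v | q
    · exact B.le_of_rel h
    · exact h.elim
    · exact h.ge
    · rcases h with h | h
      · exact h.1.ge
      · exact (Nat.le_succ i).trans (W.le_of_rel h.2)
  trans {j k x y z} hjk h₁ h₂ := by
    rcases x with u | p <;> rcases y with v | q <;> rcases z with w | r
    · exact B.trans hjk h₁ h₂
    · exact h₂.elim
    · exact h₁.elim
    · exact h₁.elim
    · have hj := B.le_of_rel h₂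
      have hk : k = i := h₁
      exact (by omega : j = i)
    · exact h₂.elim
    · exact h₂
    · rcases h₁ with ⟨rfl, h₁⟩ | ⟨h₁, hR⟩ <;> rcases h₂ with ⟨rfl, h₂⟩ | ⟨h₂, hR'⟩
      · exact .inl ⟨rfl, h₂.trans h₁⟩
      · have := W.le_of_rel hR'
        omega
      · exact .inl ⟨rfl, h₁ ▸ h₂⟩
      · exact .inr ⟨h₂.trans h₁, W.trans hjk hR hR'⟩
  eucl {j k x y z} hjk h₁ h₂ := by
    rcases x with u | p <;> rcases y with v | q <;> rcases z with w | r
    · exact B.eucl hjk h₁ h₂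
    · exact h₂.elim
    · exact h₁.elim
    · exact h₁.elim
    · have hj : j = i := h₂
      have hk : k = i := h₁
      omega
    · have hk : k = i := h₁
      rcases h₂ with ⟨rfl, -⟩ | ⟨-, hR⟩
      · omega
      · have := W.le_of_rel hR
        omega
    · exact h₂
    · rcases h₁ with ⟨rfl, h₁⟩ | ⟨h₁, hR⟩ <;> rcases h₂ with ⟨rfl, h₂⟩ | ⟨h₂, hR'⟩
      · omega
      · have := W.le_of_rel hR'
        omega
      · exact .inl ⟨rfl, h₁ ▸ h₂⟩
      · exact .inr ⟨h₂.trans h₁.symm, W.eucl hjk hR hR'⟩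
  rank_lt {j x y} h := by
    rcases x with u | p <;> rcases y with v | q
    · exact B.rank_lt h
    · exact h.elim
    · have hj : j = i := h
      subst hj
      simp only [Sum.elim_inl, Sum.elim_inr, if_true]
      exact (B.exists_bound.choose_spec v).trans_le le_self_add
    · rcases h with ⟨rfl, h⟩ | ⟨h, hR⟩
      · simpa using h
      · have := W.le_of_rel hR
        simpa [show j ≠ i by omega] using W.rank_lt hR
  rank_le {j x y} h := by
    rcases x with u | p <;> rcases y with v | q
    · exact B.rank_le h
    · exact h.elim
    · simp only [Sum.elim_inl, Sum.elim_inr, if_true]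
      exact ((B.exists_bound.choose_spec v).trans_le le_self_add).le
    · rcases h with ⟨rfl, h⟩ | ⟨h, hR⟩
      · simpa using h.le
      · simp [h]
  exists_bound := by
    refine ⟨succ (B.exists_bound.choose + ω ^ W.rank (i + 1) w₀), ?_⟩
    rintro (u | p)
    · exact ((B.exists_bound.choose_spec u).trans_le le_self_add).trans (lt_succ _)
    · simpa using p.2.2.1
  adm_univ := ⟨B.adm_univ, fun _ => Set.univ, fun _ => W.adm_univ,
    fun x hx => ⟨0, hx.bot_lt, fun _ _ _ => rfl⟩, fun _ => by simp⟩
  adm_compl {b} hb := by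
    obtain ⟨hB, a, ha, hlim, hab⟩ := hb
    refine ⟨B.adm_compl hB, fun x => (a x)ᶜ, fun x => W.adm_compl (ha x), fun x hx => ?_,
      fun p => not_congr (hab p)⟩
    obtain ⟨y, hy, h⟩ := hlim x hx
    exact ⟨y, hy, fun z hz hzx => by simp only [h z hz hzx]⟩
  adm_inter {b c} hb hc := by
    obtain ⟨hB, a, ha, hlim, hab⟩ := hb
    obtain ⟨hC, a', ha', hlim', hab'⟩ := hc
    refine ⟨B.adm_inter hB hC, fun x => a x ∩ a' x, fun x => W.adm_inter (ha x) (ha' x),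
      fun x hx => ?_, fun p => and_congr (hab p) (hab' p)⟩
    obtain ⟨y, hy, h⟩ := hlim x hx
    obtain ⟨y', hy', h'⟩ := hlim' x hx
    refine ⟨max y y', max_lt hy hy', fun z hz hzx => ?_⟩
    simp only [h z ((le_max_left _ _).trans hz) hzx, h' z ((le_max_right _ _).trans hz) hzx]
  adm_box j hb := chainAdm_box j hb
  adm_var p := ⟨B.adm_var p, fun _ => {w | .var p ∈ W.typ w}, fun _ => W.adm_var p,
    fun x hx => ⟨0, hx.bot_lt, fun _ _ _ => rfl⟩, fun _ => Iff.rfl⟩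
  mono {b j k x} hb hi hjk h y hy := by
    rcases x with u | p <;> rcases y with v | q
    · exact B.mono hb.1 hi hjk (fun z hz => h (.inl z) hz) v hy
    · exact hy.elim
    · have hk : k = i := hy
      exact h (.inl v) (by omega : j = i)
    · rcases hy with ⟨rfl, hy⟩ | ⟨hy, hR⟩
      · exact h _ (.inl ⟨by omega, hy⟩)
      · have hk := W.le_of_rel hR
        rcases hi.eq_or_lt with rfl | hi
        · exact chainAdm_mono hb h hk hy hR
        · obtain ⟨-, a, ha, -, hab⟩ := hb
          rw [hab, hy]
          refine W.mono (ha p.1.1) hi hjk (fun w hw => ?_) _ hR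
          exact (hab (p.move hw)).1 (h (.inr (p.move hw)) (.inr ⟨rfl, hw⟩))
  box_mem_typ {α ψ x} hi hD := by
    rcases x with u | p
    · rw [Sum.elim_inl, B.box_mem_typ hi hD]
      refine ⟨fun h y hy => ?_, fun h v hv => h (.inl v) hv⟩
      rcases y with v | q
      · exact h v hy
      · exact hy.elim
    · rw [Sum.elim_inr]
      rcases hi.eq_or_lt with hi | hi
      · rw [hW' _ _ _ (by omega)]
        refine ⟨fun h y hy => ?_, fun h => ?_⟩
        · rcases y with v | q
          · exact hB v α ψ hi.symm h
          · rcases hy with hy | hy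
            -- The root, which need not inherit its own boxes, occurs only in the last copy: lower
            -- positions are not nonzero multiples of `ω ^ rank w₀`.
            · refine (hW q.1.2).elim (fun hq => ?_) fun H => H α ψ (by omega) h
              have h₁ := le_of_dvd q.2.1 q.2.2.2
              rw [hq] at h₁
              exact absurd (hy.2.trans_le p.2.2.1) h₁.not_gt
            · have := W.le_of_rel hy.2
              omega
        -- A missing box is refuted in `B`, which level `i` sees from every copy.
        · by_contra hn
          obtain ⟨v, hv⟩ := hB' α ψ hi.symm hD hn
          exact hv (h (.inl v) hi.symm)
      · rw [W.box_mem_typ hi hD]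
        refine ⟨fun h y hy => ?_, fun h w hw => h (.inr (p.move hw)) (.inr ⟨rfl, hw⟩)⟩
        rcases y with v | q
        · exact absurd (show e α = i from hy) hi.ne'
        · rcases hy with hy | hy
          · exact absurd hy.1 hi.ne'
          · exact h _ hy.2

/-! ### Rooted models for all maximal consistent sets -/

/-- A model whose points other than a root labelled `t` inherit the boxed formulas of `t`. -/
def HasRoot (M : LabelledModel e D i) (t : Set (ModalFormula S)) : Prop :=
  ∃ w₀, M.typ w₀ = t ∧ (∀ w, w = w₀ ∨ ∀ α ψ, e α ≤ i → box α ψ ∈ t → ψ ∈ M.typ w) ∧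
    ∀ w α ψ, e α < i → (box α ψ ∈ M.typ w ↔ box α ψ ∈ t)

/-- The one-point model, for levels above all modalities. -/
def point (hi : ∀ α, e α < i) (t : Set (ModalFormula S)) (ht : IsMCS t) : LabelledModel e D i where
  W := PUnit
  R _ _ _ := False
  rank _ _ := 0
  adm := Set.univ
  typ _ := t
  typ_isMCS _ := ht
  le_of_rel h := h.elim
  trans _ h := h.elim
  eucl _ h := h.elim
  rank_lt h := h.elim
  rank_le h := h.elim
  exists_bound := ⟨1, fun _ => zero_lt_one⟩
  adm_univ := trivial
  adm_compl _ := trivial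
  adm_inter _ _ := trivial
  adm_box _ _ := trivial
  adm_var _ := trivial
  mono _ _ _ _ _ h := h.elim
  box_mem_typ {α _ _} h _ := absurd (hi α) h.not_gt

/-- Inner induction on the number of level-`i` boxes of `D` missing from `t`. Each such box gets a
successor of `t` refuting it; the models of these successors form the base of the chain, and the
level `i + 1` model of `t` supplies the copies. -/
theorem exists_hasRoot_step (he : StrictMono e) (hD : D.Finite)
    (ih : ∀ t, IsMCS t → ∃ M : LabelledModel e D (i + 1), M.HasRoot t) :
    ∀ t, IsMCS t → ∃ M : LabelledModel e D i, M.HasRoot t := by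
  let miss : Set (ModalFormula S) → Set (ModalFormula S) := fun t =>
    {θ | θ ∈ D ∧ θ ∉ t ∧ ∃ α χ, e α = i ∧ θ = box α χ}
  have hfin : ∀ t, (miss t).Finite := fun t => hD.subset fun _ h => h.1
  intro t ht
  induction hn : (miss t).ncard using Nat.strong_induction_on generalizing t with
  | _ n IH =>
  subst hn
  have key : ∀ c : {q : S × ModalFormula S // e q.1 = i ∧ box q.1 q.2 ∈ D ∧ box q.1 q.2 ∉ t},
      ∃ t', (∃ M : LabelledModel e D i, M.HasRoot t') ∧ c.1.2 ∉ t' ∧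
      (∀ β ψ, e β ≤ i → box β ψ ∈ t → box β ψ ∈ t' ∧ ψ ∈ t') ∧
      (∀ β ψ, e β < i → (box β ψ ∈ t' ↔ box β ψ ∈ t)) := by
    rintro ⟨⟨α, χ⟩, hα, hχD, hχt⟩
    obtain ⟨t', ht', hχ, hbox, hpos, hcont⟩ := ht.exists_succ hχt
    have hpos' : ∀ β ψ, e β ≤ i → box β ψ ∈ t → box β ψ ∈ t' ∧ ψ ∈ t' := fun β ψ hβ =>
      hpos β (he.le_iff_le.1 (hβ.trans hα.ge)) ψ
    refine ⟨t', IH _ ?_ t' ht' rfl, hχ, hpos', fun β ψ hβ =>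
      hcont β (he.lt_iff_lt.1 (hβ.trans_eq hα.symm)) ψ⟩
    -- The successor keeps all level-`i` boxes of `t` and, by Löb, gains `box α χ`, so fewer are
    -- missing.
    refine Set.ncard_lt_ncard ((Set.ssubset_iff_of_subset ?_).2
      ⟨box α χ, ⟨hχD, hχt, α, χ, hα, rfl⟩, fun h => h.2.1 hbox⟩) (hfin t)
    rintro _ ⟨h₁, h₂, β, ψ, hβ, rfl⟩
    exact ⟨h₁, fun h => h₂ (hpos' β ψ hβ.le h).1, β, ψ, hβ, rfl⟩
  choose t' hM hχ hpos hcont using key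
  choose M v hv hroot hcont' using hM
  obtain ⟨W, w₀, rfl, hW, hW'⟩ := ih t ht
  have hsucc : ∀ c x β ψ, e β ≤ i → box β ψ ∈ W.typ w₀ → ψ ∈ (M c).typ x := by
    intro c x β ψ hβ h
    have h' := hpos c β ψ hβ h
    rcases hroot c x with rfl | hx
    · rw [hv]
      exact h'.2
    · exact hx β ψ hβ h'.1
  refine ⟨chain (sigma M) W w₀ hW hW' (fun x α ψ hα h => hsucc x.1 x.2 α ψ hα.le h)
    (fun α ψ hα h₁ h₂ => ⟨⟨⟨(α, ψ), hα, h₁, h₂⟩, v _⟩, ?_⟩),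
    .inr ⟨(ω ^ W.rank (i + 1) w₀, w₀), (opow_pos _ omega0_pos).ne', le_rfl, dvd_rfl⟩, rfl, ?_, ?_⟩
  · change ψ ∉ (M _).typ (v _)
    rw [hv]
    exact hχ _
  · rintro (x | p)
    · exact .inr fun α ψ hα h => hsucc x.1 x.2 α ψ hα h
    · rcases hW p.1.2 with h | h
      · left
        have h₁ := le_of_dvd p.2.1 p.2.2.2
        rw [h] at h₁
        exact congrArg Sum.inr (Subtype.ext (Prod.ext (p.2.2.1.antisymm h₁) h))
      · exact .inr fun α ψ hα => h α ψ (by omega)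
  · rintro (x | p) α ψ hα
    · exact (hcont' x.1 x.2 α ψ hα).trans (hcont x.1 α ψ hα)
    · exact hW' p.1.2 α ψ (by omega)

theorem exists_hasRoot (he : StrictMono e) (hD : D.Finite) {N : ℕ} (hN : ∀ α, e α < N)
    {t : Set (ModalFormula S)} (ht : IsMCS t) : ∃ M : LabelledModel e D 0, M.HasRoot t := by
  suffices h : ∀ t, IsMCS t → ∃ M : LabelledModel e D 0, M.HasRoot t from h t ht
  refine Nat.decreasingInduction (motive := fun i _ =>
    ∀ t, IsMCS t → ∃ M : LabelledModel e D i, M.HasRoot t)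
    (fun i _ ih => exists_hasRoot_step he hD ih) (fun t ht => ?_) (Nat.zero_le N)
  exact ⟨point hN t ht, PUnit.unit, rfl, fun _ => .inl rfl, fun _ _ _ _ => Iff.rfl⟩

/-! ### Soundness and the truth lemma -/

/-- Truth at a point of a model. -/
def Sat (M : LabelledModel e D i) (x : M.W) : ModalFormula ℕ → Prop
  | .var p => .var p ∈ M.typ x
  | .top => True
  | .neg φ => ¬ M.Sat x φ
  | .and φ ψ => M.Sat x φ ∧ M.Sat x ψ
  | .box j φ => ∀ y, M.R j x y → M.Sat y φ

theorem sat_imp (M : LabelledModel e D i) {x : M.W} {φ ψ : ModalFormula ℕ} :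
    M.Sat x (imp φ ψ) ↔ (M.Sat x φ → M.Sat x ψ) := by
  simp [imp, Sat]

theorem adm_sat (M : LabelledModel e D i) (φ : ModalFormula ℕ) : {x | M.Sat x φ} ∈ M.adm := by
  induction φ with
  | var p => exact M.adm_var p
  | top => exact M.adm_univ
  | neg φ ih => exact M.adm_compl ih
  | and φ ψ ih₁ ih₂ => exact M.adm_inter ih₁ ih₂
  | box j φ ih => exact M.adm_box j ih

theorem sat_subst (M : LabelledModel e D i) (x : M.W) (σ : ℕ → ModalFormula ℕ) (τ : PropFormula) :
    M.Sat x (τ.subst σ) ↔ τ.Eval fun p => M.Sat x (σ p) := by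
  induction τ <;> simp_all [Sat, PropFormula.subst, PropFormula.Eval]

theorem sat_of_glp (M : LabelledModel e D 0) {φ : ModalFormula ℕ} (h : GLP ℕ φ) (x : M.W) :
    M.Sat x φ := by
  induction h generalizing x with
  | taut τ hτ σ => exact (M.sat_subst x σ τ).2 (hτ _)
  | distr j χ ψ =>
    simp only [sat_imp, Sat]
    exact fun h₁ h₂ y hy => h₁ y hy (h₂ y hy)
  | loeb j χ =>
    simp only [sat_imp, Sat]
    intro h y hy
    induction hr : M.rank j y using WellFoundedLT.induction generalizing y with
    | ind r ih =>
      subst hr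
      exact h y hy fun z hz => ih _ (M.rank_lt hz) z (M.trans le_rfl hy hz) rfl
  | box_box j k hjk χ =>
    simp only [sat_imp, Sat]
    exact fun h y hy z hz => h z (M.trans hjk hy hz)
  | dia_box_dia j k hjk χ =>
    simp only [sat_imp, Sat, dia]
    exact fun h y hy H => h fun z hz => H z (M.eucl hjk hy hz)
  | mono j k hjk χ =>
    simp only [sat_imp, Sat]
    -- Monotonicity is available because truth sets are admissible.
    exact M.mono (M.adm_sat χ) (Nat.zero_le j) hjk
  | mp χ ψ _ _ ih₁ ih₂ => exact M.sat_imp.1 (ih₁ x) (ih₂ x)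
  | nec j χ _ ih => exact fun y _ => ih y

/-- At level `0`, `box_mem_typ` covers every modal, so truth and labels agree on the
subformula-closed set `D`. -/
theorem sat_rename (M : LabelledModel e D 0) (hneg : ∀ ψ, neg ψ ∈ D → ψ ∈ D)
    (hand : ∀ ψ χ, .and ψ χ ∈ D → ψ ∈ D ∧ χ ∈ D) (hbox : ∀ α ψ, box α ψ ∈ D → ψ ∈ D)
    {φ : ModalFormula S} (hφ : φ ∈ D) (x : M.W) : M.Sat x (φ.rename e) ↔ φ ∈ M.typ x := by
  induction φ generalizing x with
  | var p => exact Iff.rfl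
  | top => exact ⟨fun _ => (M.typ_isMCS x).thm_mem GLP.top_intro, fun _ => trivial⟩
  | neg φ ih => exact (not_congr (ih (hneg _ hφ) x)).trans (M.typ_isMCS x).neg_mem.symm
  | and φ ψ ih₁ ih₂ =>
    exact (and_congr (ih₁ (hand _ _ hφ).1 x) (ih₂ (hand _ _ hφ).2 x)).trans
      (M.typ_isMCS x).and_mem.symm
  | box α φ ih =>
    rw [M.box_mem_typ (Nat.zero_le _) hφ]
    exact forall_congr' fun y => imp_congr_right fun _ => ih (hbox _ _ hφ) y

end LabelledModel

/-! ### Conservativity -/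

/-- Conservativity of `GLP_ω` over the logics with finitely many of its modalities. -/
theorem GLP.of_rename_nat {S : Type} [LinearOrder S] {e : S → ℕ} (he : StrictMono e) {N : ℕ}
    (hN : ∀ α, e α < N) {φ : ModalFormula S} (h : GLP ℕ (φ.rename e)) : GLP S φ := by
  by_contra hn
  have hd : ¬ Deriv ∅ φ := fun d => hn <| by
    clear h hn
    induction d with
    | thm h => exact h
    | hyp h => exact h.elim
    | mp _ _ ih₁ ih₂ => exact .mp _ _ ih₁ ih₂
  obtain ⟨t, ht, -, hφ⟩ := exists_isMCS hd
  obtain ⟨D, hD, hφD, hneg, hand, hbox⟩ := exists_finite_subformula_closed φ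
  obtain ⟨M, w₀, rfl, -⟩ := LabelledModel.exists_hasRoot he hD hN ht
  exact hφ ((M.sat_rename hneg hand hbox hφD w₀).1 (M.sat_of_glp h w₀))

/-- A logic is conservative over its finite fragments, up to a renaming of the modalities. -/
theorem GLP.rename_iff {Λ : Type u} [LinearOrder Λ] {n : ℕ} {f : Fin n → Λ} (hf : StrictMono f)
    (φ : ModalFormula (Fin n)) : GLP Λ (φ.rename f) ↔ GLP (Fin n) φ := by
  refine ⟨fun h => ?_, GLP.rename hf⟩
  obtain ⟨F, hF⟩ := h.exists_finset_proj
  -- Adding the range of `f` ensures that no box of `φ.rename f` is erased.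
  let G := F ∪ Finset.univ.image f
  have hG : ∀ k, f k ∈ G := fun k => Finset.mem_union_right _ (by simp)
  have h₁ := hF G Finset.subset_union_left
  rw [proj_rename G f hG] at h₁
  let g : G → ℕ := fun x => ((G.orderIsoOfFin rfl).symm x).val
  have hg : StrictMono g := fun x y hxy => (G.orderIsoOfFin rfl).symm.strictMono hxy
  have h₂ := h₁.rename hg
  rw [rename_rename] at h₂
  exact GLP.of_rename_nat (N := G.card)
    (hg.comp fun a b hab => show (⟨f a, hG a⟩ : G) < ⟨f b, hG b⟩ from hf hab)
    (fun k => Fin.is_lt _) h₂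

/-- A formula is recovered from its condensation by the increasing enumeration of its modals. -/
theorem ModalFormula.exists_rename_hat {Λ : Type u} [LinearOrder Λ] (φ : ModalFormula Λ) :
    ∃ f : Fin φ.mods.card → Λ, StrictMono f ∧ φ.hat.rename f = φ := by
  refine ⟨Subtype.val ∘ φ.mods.orderIsoOfFin rfl,
    fun a b hab => (φ.mods.orderIsoOfFin rfl).strictMono hab, ?_⟩
  have h : (Subtype.val ∘ φ.mods.orderIsoOfFin rfl) ∘ (φ.mods.orderIsoOfFin rfl).symm =
      Subtype.val := funext fun x => by simp
  rw [hat, rename_rename, h]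
  exact rename_restrict _ _ _

theorem GLP.iff_hat {Λ : Type u} [LinearOrder Λ] (φ : ModalFormula Λ) :
    GLP Λ φ ↔ GLP (Fin φ.mods.card) φ.hat := by
  obtain ⟨f, hf, h⟩ := φ.exists_rename_hat
  exact (iff_of_eq (congrArg (GLP Λ) h.symm)).trans (GLP.rename_iff hf φ.hat)

theorem theorem3p1 (Λ : Type*) [LinearOrder Λ] :
    (∀ (S : Set Λ) (φ : ModalFormula S), GLP Λ φ.incl ↔ GLP S φ) ∧
    (∀ φ : ModalFormula Λ,
      (GLP Λ φ ↔ GLP (Fin φ.mods.card) φ.hat) ∧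
      (GLP (Fin φ.mods.card) φ.hat ↔ GLP ℕ (φ.hat.rename Fin.val))) := by
  refine ⟨fun S φ => ?_, fun φ => ⟨GLP.iff_hat φ, (GLP.rename_iff Fin.val_strictMono _).symm⟩⟩
  -- Both `φ` and `φ.incl` are increasing renamings of `φ.hat`, so each is provable exactly when
  -- `φ.hat` is.
  obtain ⟨f, hf, h⟩ := φ.exists_rename_hat
  have h' : φ.incl = φ.hat.rename (Subtype.val ∘ f) := by
    rw [← rename_rename, h]
    rfl
  rw [h', GLP.iff_hat φ]
  exact GLP.rename_iff (f := Subtype.val ∘ f) (fun a b hab => hf hab) _
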